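/- Let $p$ be a prime, $q$ a positive power of $p$, and $\mathbb{F}_{q^2}$ the field with $q^2$ elements. For $f(x)=a_0+a_1x+\dots+a_kx^k\in\mathbb{F}_{q^2}[x]$ of degree $k$ with $a_0\neq 0$, put $f^\dagger(x):=a_0^{-q}\sum_{i=0}^k a_i^q x^{k-i}$; call $f$ self-conjugate-reciprocal if $f=f^\dagger$, and call $f,f^\dagger$ a conjugate-reciprocal pair otherwise. Let $n=\overline{n}p^\nu$ be a positive integer with $p\nmid\overline{n}$ and $\nu\ge 0$, let $\lambda\in\mathbb{F}_{q^2}\setminus\{0\}$ have multiplicative order $r$ with $r\mid q+1$, and let $\Lambda\in\mathbb{F}_{q^2}$ satisfy $\Lambda^{p^\nu}=\lambda$. Then $x^{\overline{n}}-\Lambda$ has a factorization $$x^{\overline{n}}-\Lambda=\prod_{i=1}^{s}g_i(x)\prod_{j=1}^{t}f_j(x)f_j^\dagger(x)$$ with integers $s,t\ge 0$, where each $g_i$ is monic, irreducible and self-conjugate-reciprocal, and each $f_j$ is monic and irreducible and forms a conjugate-reciprocal pair with $f_j^\dagger$. For every such factorization, the number $B^H_{\overline{n},\lambda,q^2}:=\sum_{i=1}^{s}\deg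 g_i$ satisfies $$B^H_{\overline{n},\lambda,q^2}=\sum_{j\in\chi\cap M_q}\frac{\phi(j)}{\phi(r)},$$ where $\phi$ is Euler's totient function, $\chi=\{j\ge 1 : j\mid \overline{n}r,\ \gcd(\overline{n}r/j,\,r)=1\}$ and $M_q=\{\ell\ge 1 : \ell\mid q^i+1 \text{ for some odd positive integer } i\}$. -/

import Mathlib

open Polynomial

namespace HermitianHull

variable {F : Type*} [Field F]

/-- The conjugate-reciprocal polynomial `f† = a₀^{-q} ∑_{i=0}^{k} a_i^q x^{k-i}` of
`f = a₀ + a₁ x + ⋯ + a_k x^k`, of degree `k`. It is only meaningful when `a₀ ≠ 0`. -/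
noncomputable def dagger (q : ℕ) (f : F[X]) : F[X] :=
  C ((f.coeff 0 ^ q)⁻¹) *
    ∑ i ∈ Finset.range (f.natDegree + 1), C (f.coeff i ^ q) * X ^ (f.natDegree - i)

/-- `f` has nonzero constant term and `f = f†`. -/
def IsSelfConjRecip (q : ℕ) (f : F[X]) : Prop :=
  f.coeff 0 ≠ 0 ∧ f = dagger q f

/-- `f` has nonzero constant term and `f ≠ f†`, so that `f` and `f†` form a
conjugate-reciprocal polynomial pair. -/
def IsConjRecipPair (q : ℕ) (f : F[X]) : Prop :=
  f.coeff 0 ≠ 0 ∧ f ≠ dagger q f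

/-- A factorization `P = ∏_{i=1}^{s} g_i ∏_{j=1}^{t} f_j f_j†`, in which each `g_i` is monic,
irreducible and self-conjugate-reciprocal, and each `f_j` is monic and irreducible and forms a
conjugate-reciprocal polynomial pair with `f_j†`. -/
structure Factorization (q : ℕ) (P : F[X]) where
  /-- number of self-conjugate-reciprocal factors -/
  s : ℕ
  /-- number of conjugate-reciprocal pairs -/
  t : ℕ
  /-- the self-conjugate-reciprocal factors -/
  g : Fin s → F[X]
  /-- the first members of the conjugate-reciprocal pairs -/
  f : Fin t → F[X]
  g_monic : ∀ i, (g i).Monic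
  g_irreducible : ∀ i, Irreducible (g i)
  g_self : ∀ i, IsSelfConjRecip q (g i)
  f_monic : ∀ j, (f j).Monic
  f_irreducible : ∀ j, Irreducible (f j)
  f_pair : ∀ j, IsConjRecipPair q (f j)
  eq_prod : P = (∏ i, g i) * ∏ j, (f j * dagger q (f j))

/-- The sum of the degrees of the self-conjugate-reciprocal factors. -/
noncomputable def Factorization.B {q : ℕ} {P : F[X]} (fac : Factorization q P) : ℕ :=
  ∑ i, (fac.g i).natDegree

/-- The set `M_q` of positive divisors of `q^i + 1` for some odd positive integer `i`. -/
def M (q : ℕ) : Set ℕ := {l | 1 ≤ l ∧ ∃ i : ℕ, 0 < i ∧ Odd i ∧ l ∣ q ^ i + 1}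

/-- The set `χ` of positive divisors `j` of `n̄ r` with `gcd(n̄ r / j, r) = 1`. -/
def chi (nb r : ℕ) : Finset ℕ :=
  {j ∈ (nb * r).divisors | Nat.gcd (nb * r / j) r = 1}

end HermitianHull

/-! In a finite extension `K` of `F`, the roots of an irreducible `g` form one orbit of `x ↦
x^(q²)`, and the roots of `g†` are the `x^(-q)`. So `g = g†` iff `x^(-q)` is conjugate to `x`, that
is, `x^(q^i+1) = 1` for some odd `i` (`eq_dagger_iff_orderOf_mem`). As `x` and `x^(-q)` have equal
order, no root of a pair `f f†` has order in `M q`; hence for every factorization the degree sum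
counts the roots of order in `M q` (`Factorization.B_eq_card`).

The roots are simple. Since `Λ` has order `r`, their orders lie in `χ`, and for `j ∈ χ` the map `x ↦
x^nb` from elements of order `j` to elements of order `r` has fibres of equal size `φ(j)/φ(r)`
(`card_pow_fiber_mul_totient`).

Existence follows by induction on degree, as `r ∣ q + 1` makes the polynomial fixed by `†`. -/

namespace HermitianHull

/-! ### Conjugate-reciprocals and existence of the factorization -/

section Dagger

variable {F : Type*} [Field F] {q : ℕ} {φ : F →+* F}

theorem reverse_map_of_field (f : F[X]) : (f.map φ).reverse = f.reverse.map φ := by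
  rw [reverse, reverse, natDegree_map, reflect_map]

theorem natDegree_reverse_of_coeff_zero_ne {f : F[X]} (h0 : f.coeff 0 ≠ 0) :
    f.reverse.natDegree = f.natDegree := by
  rw [reverse_natDegree, natTrailingDegree_eq_zero.2 (Or.inr h0), Nat.sub_zero]

theorem reverse_reverse_of_coeff_zero_ne {f : F[X]} (h0 : f.coeff 0 ≠ 0) :
    f.reverse.reverse = f := by
  rw [reverse, natDegree_reverse_of_coeff_zero_ne h0, reverse, reflect_reflect]

/-- The conjugate-reciprocal is, up to a scalar, the reversal of the Frobenius twist. -/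
theorem dagger_eq (hφ : ∀ x, φ x = x ^ q) (f : F[X]) :
    dagger q f = C (φ (f.coeff 0))⁻¹ * (f.map φ).reverse := by
  rw [dagger, hφ, reverse, natDegree_map]
  congr 1
  ext k
  rw [coeff_reflect, finsetSum_coeff, coeff_map, hφ]
  simp only [coeff_C_mul_X_pow]
  rcases le_or_gt k f.natDegree with hk | hk
  · rw [Finset.sum_eq_single (f.natDegree - k), revAt_le hk, if_pos (by omega)]
    · intro b hb hne
      rw [Finset.mem_range] at hb
      exact if_neg (by omega)
    · intro h
      exact absurd (Finset.mem_range.2 (by omega)) h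
  · rw [revAt_eq_self_of_lt hk, coeff_eq_zero_of_natDegree_lt hk, ← hφ, map_zero]
    exact Finset.sum_eq_zero fun b _ => if_neg (by omega)

theorem dagger_mul (hφ : ∀ x, φ x = x ^ q) (f g : F[X]) :
    dagger q (f * g) = dagger q f * dagger q g := by
  simp only [dagger_eq hφ, mul_coeff_zero, Polynomial.map_mul, reverse_mul_of_domain, map_mul,
    mul_inv]
  ring

theorem coeff_zero_dagger (hφ : ∀ x, φ x = x ^ q) {f : F[X]} (hf : f.Monic) :
    (dagger q f).coeff 0 = (φ (f.coeff 0))⁻¹ := by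
  rw [dagger_eq hφ, coeff_C_mul, coeff_zero_reverse, (hf.map φ).leadingCoeff, mul_one]

theorem natDegree_dagger (hφ : ∀ x, φ x = x ^ q) {f : F[X]} (h0 : f.coeff 0 ≠ 0) :
    (dagger q f).natDegree = f.natDegree := by
  have h1 : φ (f.coeff 0) ≠ 0 := (map_ne_zero φ).2 h0
  rw [dagger_eq hφ, natDegree_C_mul (inv_ne_zero h1), natDegree_reverse_of_coeff_zero_ne,
    natDegree_map]
  rwa [coeff_map]

theorem dagger_monic (hφ : ∀ x, φ x = x ^ q) {f : F[X]} (h0 : f.coeff 0 ≠ 0) :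
    (dagger q f).Monic := by
  have h1 : φ (f.coeff 0) ≠ 0 := (map_ne_zero φ).2 h0
  rw [Monic, dagger_eq hφ, leadingCoeff_mul, leadingCoeff_C, reverse_leadingCoeff, trailingCoeff,
    natTrailingDegree_eq_zero.2 (Or.inr (by rwa [coeff_map])), coeff_map, inv_mul_cancel₀ h1]

theorem dagger_dagger (hφ : ∀ x, φ x = x ^ q) (hinv : ∀ x, φ (φ x) = x) {f : F[X]}
    (hf : f.Monic) (h0 : f.coeff 0 ≠ 0) : dagger q (dagger q f) = f := by
  have hφφ : φ.comp φ = RingHom.id F := RingHom.ext hinv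
  rw [dagger_eq hφ (dagger q f), coeff_zero_dagger hφ hf, dagger_eq hφ f, Polynomial.map_mul,
    reverse_mul_of_domain, map_C, reverse_C, ← reverse_map_of_field, map_map, hφφ, map_id,
    reverse_reverse_of_coeff_zero_ne h0, ← mul_assoc, ← C_mul, inv_mul_cancel₀, C_1, one_mul]
  simpa using h0

/-- The hypothesis on `a` says that `φ a = a⁻¹`, so normalizing `1 - φ(a) x^n` restores the constant
`a`. -/
theorem dagger_X_pow_sub_C (hφ : ∀ x, φ x = x ^ q) {n : ℕ} (hn : n ≠ 0) {a : F}
    (ha : a ^ (q + 1) = 1) : dagger q (X ^ n - C a) = X ^ n - C a := by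
  have ha0 : a ≠ 0 := by
    rintro rfl
    simp at ha
  have h1 : φ a ≠ 0 := (map_ne_zero φ).2 ha0
  have h2 : φ a * a = 1 := by rw [hφ, ← pow_succ, ha]
  have h3 : (φ a)⁻¹ = a := inv_eq_of_mul_eq_one_right h2
  have h0 : (X ^ n - C a : F[X]).coeff 0 = -a := by simp [hn.symm]
  rw [dagger_eq hφ, h0, Polynomial.map_sub, Polynomial.map_pow, map_X, map_C, reverse,
    natDegree_X_pow_sub_C, reflect_sub, reflect_C, reflect_monomial, revAt_le le_rfl, Nat.sub_self,
    pow_zero, map_neg, inv_neg, h3, mul_sub, mul_one, ← mul_assoc, ← C_mul, neg_mul, mul_comm a,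
    h2]
  simp only [C_neg, C_1]
  ring

/-- Adjoin a self-conjugate-reciprocal factor to a factorization. -/
theorem Factorization.nonempty_mul_self {g P : F[X]} (hg : g.Monic) (hi : Irreducible g)
    (hs : IsSelfConjRecip q g) (h : Nonempty (Factorization q P)) :
    Nonempty (Factorization q (g * P)) := by
  obtain ⟨fac⟩ := h
  refine ⟨⟨fac.s + 1, fac.t, Fin.cons g fac.g, fac.f, ?_, ?_, ?_, fac.f_monic,
    fac.f_irreducible, fac.f_pair, ?_⟩⟩
  · exact Fin.cases hg fac.g_monic
  · exact Fin.cases hi fac.g_irreducible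
  · exact Fin.cases hs fac.g_self
  · rw [Fin.prod_univ_succ, Fin.cons_zero]
    simp only [Fin.cons_succ]
    rw [mul_assoc, ← fac.eq_prod]

/-- Adjoin a conjugate-reciprocal pair to a factorization. -/
theorem Factorization.nonempty_mul_pair {f P : F[X]} (hf : f.Monic) (hi : Irreducible f)
    (hs : IsConjRecipPair q f) (h : Nonempty (Factorization q P)) :
    Nonempty (Factorization q (f * dagger q f * P)) := by
  obtain ⟨fac⟩ := h
  refine ⟨⟨fac.s, fac.t + 1, fac.g, Fin.cons f fac.f, fac.g_monic, fac.g_irreducible, fac.g_self,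
    ?_, ?_, ?_, ?_⟩⟩
  · exact Fin.cases hf fac.f_monic
  · exact Fin.cases hi fac.f_irreducible
  · exact Fin.cases hs fac.f_pair
  · rw [Fin.prod_univ_succ, Fin.cons_zero]
    simp only [Fin.cons_succ]
    conv_lhs => rw [fac.eq_prod]
    ring

/-- A monic self-conjugate-reciprocal polynomial has a factorization into irreducible
self-conjugate-reciprocal factors and conjugate-reciprocal pairs. -/
theorem Factorization.nonempty_of_dagger_eq (hφ : ∀ x, φ x = x ^ q) (hinv : ∀ x, φ (φ x) = x)
    (P : F[X]) (hP : P.Monic) (h0 : P.coeff 0 ≠ 0) (hd : dagger q P = P) :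
    Nonempty (Factorization q P) := by
  induction hN : P.natDegree using Nat.strong_induction_on generalizing P with
  | _ N ih =>
  subst hN
  by_cases hdeg : P.natDegree = 0
  · rw [hP.natDegree_eq_zero.1 hdeg]
    exact ⟨⟨0, 0, Fin.elim0, Fin.elim0, (·.elim0), (·.elim0), (·.elim0), (·.elim0), (·.elim0),
      (·.elim0), by simp⟩⟩
  obtain ⟨g, hg, hi, Q, hQ⟩ := exists_monic_irreducible_factor P
    (fun hu => hdeg (natDegree_eq_zero_of_isUnit hu))
  have hg0 : g.coeff 0 ≠ 0 := by
    intro h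
    rw [hQ, mul_coeff_zero, h, zero_mul] at h0
    exact h0 rfl
  have hgdeg : 0 < g.natDegree := hi.natDegree_pos
  by_cases hs : g = dagger q g
  · have hQm : Q.Monic := hg.of_mul_monic_left (hQ ▸ hP)
    rw [hQ]
    refine nonempty_mul_self hg hi ⟨hg0, hs⟩ (ih Q.natDegree ?_ Q hQm ?_ ?_ rfl)
    · rw [hQ, hg.natDegree_mul hQm]
      omega
    · intro h
      rw [hQ, mul_coeff_zero, h, mul_zero] at h0
      exact h0 rfl
    · rw [hQ, dagger_mul hφ, ← hs] at hd
      exact mul_left_cancel₀ hg.ne_zero hd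
  · have hgd := dagger_monic hφ hg0
    have hdvd : dagger q g ∣ P := ⟨dagger q Q, by rw [← dagger_mul hφ, ← hQ, hd]⟩
    -- Both are monic of the same degree, so `g ∣ g†` would force equality.
    have hcop : IsCoprime g (dagger q g) := by
      rw [hi.coprime_iff_not_dvd]
      intro h
      exact hs (eq_of_dvd_of_natDegree_le_of_leadingCoeff h (natDegree_dagger hφ hg0).le
        (hg.leadingCoeff.trans hgd.leadingCoeff.symm))
    obtain ⟨R, hR⟩ := hcop.mul_dvd ⟨Q, hQ⟩ hdvd
    have hm : (g * dagger q g).Monic := hg.mul hgd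
    have hRm : R.Monic := hm.of_mul_monic_left (hR ▸ hP)
    rw [hR]
    refine nonempty_mul_pair hg hi ⟨hg0, hs⟩ (ih R.natDegree ?_ R hRm ?_ ?_ rfl)
    · rw [hR, hm.natDegree_mul hRm, hg.natDegree_mul hgd]
      omega
    · intro h
      rw [hR, mul_coeff_zero, h, mul_zero] at h0
      exact h0 rfl
    · rw [hR, dagger_mul hφ, dagger_mul hφ, dagger_dagger hφ hinv hg hg0,
        mul_comm (dagger q g)] at hd
      exact mul_left_cancel₀ hm.ne_zero hd

end Dagger

/-! ### Orders of roots and fibres of the power map -/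

section Counting

/-- The quotient is the order of `x^nb` for `x` of order `j`. If `nb * r = j * k` with `k` prime to
`r`, then `k ∣ nb` and `j.gcd nb = nb / k`. -/
theorem mem_chi_iff {nb r j : ℕ} (hnb : nb ≠ 0) (hr : r ≠ 0) :
    j ∈ chi nb r ↔ j ≠ 0 ∧ j / j.gcd nb = r := by
  rw [chi, Finset.mem_filter, Nat.mem_divisors]
  constructor
  · rintro ⟨⟨⟨k, hk⟩, -⟩, hg⟩
    have hj : j ≠ 0 := by
      rintro rfl
      simp [hnb, hr] at hk
    rw [hk, Nat.mul_div_cancel_left _ (Nat.pos_of_ne_zero hj)] at hg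
    have hkn : k ∣ nb := Nat.Coprime.dvd_of_dvd_mul_right hg (hk ▸ Dvd.intro_left j rfl)
    obtain ⟨g, rfl⟩ := hkn
    have hk0 : 0 < k := Nat.pos_of_ne_zero fun h => hnb (by simp [h])
    have hg0 : 0 < g := Nat.pos_of_ne_zero fun h => hnb (by simp [h])
    have hjr : j = g * r := by
      apply Nat.eq_of_mul_eq_mul_left hk0
      rw [mul_comm k j, ← hk]
      ring
    refine ⟨hj, ?_⟩
    have : j.gcd (k * g) = g := by
      rw [hjr, mul_comm k g, Nat.gcd_mul_left, Nat.gcd_comm, hg, mul_one]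
    rw [this, hjr, Nat.mul_div_cancel_left _ hg0]
  · rintro ⟨hj, rfl⟩
    have hg0 : 0 < j.gcd nb := Nat.gcd_pos_of_pos_left _ (Nat.pos_of_ne_zero hj)
    obtain ⟨a, ha⟩ := Nat.gcd_dvd_left j nb
    obtain ⟨b, hb⟩ := Nat.gcd_dvd_right j nb
    have hcop := Nat.coprime_div_gcd_div_gcd hg0
    have hja : j / j.gcd nb = a := Nat.div_eq_of_eq_mul_right hg0 ha
    have hnbb : nb / j.gcd nb = b := Nat.div_eq_of_eq_mul_right hg0 hb
    rw [hja, hnbb] at hcop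
    have hprod : nb * (j / j.gcd nb) = j * b := by
      calc nb * (j / j.gcd nb) = (j.gcd nb * b) * a := by rw [hja, ← hb]
        _ = (j.gcd nb * a) * b := by ring
        _ = j * b := by rw [← ha]
    refine ⟨⟨Dvd.intro b hprod.symm, mul_ne_zero hnb hr⟩, ?_⟩
    rw [hprod, Nat.mul_div_cancel_left _ (Nat.pos_of_ne_zero hj), hja]
    exact hcop.symm

theorem orderOf_mem_chi_iff {G : Type*} [Monoid G] {nb r : ℕ} (hnb : nb ≠ 0) (hr : r ≠ 0) {x : G}
    (hx : orderOf x ≠ 0) : orderOf x ∈ chi nb r ↔ orderOf (x ^ nb) = r := by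
  rw [mem_chi_iff hnb hr, orderOf_pow' x hnb, and_iff_right hx]

variable {K : Type*} [Field K] [DecidableEq K]

/-- Elements of equal order have equally many `nb`-th roots of order `j`. -/
theorem card_pow_fiber_le {j nb r : ℕ} (hj : j ≠ 0) (hrj : r ∣ j) {a b : K}
    (ha : orderOf a = r) (hb : orderOf b = r) :
    ((primitiveRoots j K).filter (· ^ nb = a)).card ≤
      ((primitiveRoots j K).filter (· ^ nb = b)).card := by
  have hr : r ≠ 0 := by
    rintro rfl
    exact hj (zero_dvd_iff.1 hrj)
  have : NeZero j := ⟨hj⟩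
  have : NeZero r := ⟨hr⟩
  have hap : IsPrimitiveRoot a r := ha ▸ IsPrimitiveRoot.orderOf a
  have hbp : IsPrimitiveRoot b r := hb ▸ IsPrimitiveRoot.orderOf b
  obtain ⟨i, -, hi⟩ := hap.eq_pow_of_pow_eq_one hbp.pow_eq_one
  have hir : i.Coprime r := (hap.pow_iff_coprime (Nat.pos_of_ne_zero hr) i).1 (hi ▸ hbp)
  -- With `b = a^i`, lift `i` to a unit `u` mod `j`: then `x ↦ x^u` preserves order `j` and carries
  -- the fibre over `a` into that over `b`; the exponent `u⁻¹` undoes it.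
  obtain ⟨u, hu⟩ := ZMod.unitsMap_surjective hrj (ZMod.unitOfCoprime i hir)
  have hcop : (u : ZMod j).val.Coprime j := ZMod.val_coe_unit_coprime u
  have hmod : (u : ZMod j).val ≡ i [MOD r] := by
    rw [← ZMod.natCast_eq_natCast_iff]
    have h := congrArg (Units.val) hu
    rw [ZMod.unitsMap_def, Units.coe_map, ZMod.coe_unitOfCoprime] at h
    rw [← h]
    exact ZMod.natCast_val _
  have hinv : (u : ZMod j).val * ((u⁻¹ : (ZMod j)ˣ) : ZMod j).val ≡ 1 [MOD j] := by
    rw [← ZMod.natCast_eq_natCast_iff]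
    push_cast
    rw [ZMod.natCast_zmod_val, ZMod.natCast_zmod_val, Units.mul_inv]
  have key : ∀ x : K, x ∈ primitiveRoots j K →
      (x ^ (u : ZMod j).val) ^ ((u⁻¹ : (ZMod j)ˣ) : ZMod j).val = x := by
    intro x hx
    have hx' := (mem_primitiveRoots (Nat.pos_of_ne_zero hj)).1 hx
    rw [← pow_mul]
    conv_rhs => rw [← pow_one x]
    exact pow_eq_pow_of_modEq hinv hx'.pow_eq_one
  refine Finset.card_le_card_of_injOn (· ^ (u : ZMod j).val) ?_ ?_
  · intro x hx
    obtain ⟨hx, hxa⟩ := Finset.mem_filter.1 (Finset.mem_coe.1 hx)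
    refine Finset.mem_coe.2 (Finset.mem_filter.2 ⟨?_, ?_⟩)
    · rw [mem_primitiveRoots (Nat.pos_of_ne_zero hj)] at hx ⊢
      exact hx.pow_of_coprime _ hcop
    · show (x ^ (u : ZMod j).val) ^ nb = b
      rw [← pow_mul, mul_comm, pow_mul, hxa, ← hi]
      exact pow_eq_pow_of_modEq hmod hap.pow_eq_one
  · intro x hx y hy hxy
    rw [← key x (Finset.mem_filter.1 (Finset.mem_coe.1 hx)).1,
      ← key y (Finset.mem_filter.1 (Finset.mem_coe.1 hy)).1]
    exact congrArg (· ^ ((u⁻¹ : (ZMod j)ˣ) : ZMod j).val) hxy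

/-- An element of order `r` has `φ(j) / φ(r)` roots of order `j`, for `j ∈ χ`. -/
theorem card_pow_fiber_mul_totient {j nb r : ℕ} (hnb : nb ≠ 0) (hr : r ≠ 0) {ζ : K}
    (hζ : IsPrimitiveRoot ζ (nb * r)) (hj : j ∈ chi nb r) {a : K} (ha : orderOf a = r) :
    ((primitiveRoots j K).filter (· ^ nb = a)).card * r.totient = j.totient := by
  have hN : nb * r ≠ 0 := mul_ne_zero hnb hr
  obtain ⟨hj0, hjr⟩ := (mem_chi_iff hnb hr).1 hj
  have hrj : r ∣ j := hjr ▸ Nat.div_dvd_of_dvd (Nat.gcd_dvd_left j nb)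
  have hjN : j ∣ nb * r := Nat.dvd_of_mem_divisors (Finset.mem_filter.1 hj).1
  obtain ⟨c, hc⟩ := hjN
  have hζj : IsPrimitiveRoot (ζ ^ c) j :=
    hζ.pow (Nat.pos_of_ne_zero hN) (by rw [hc, mul_comm])
  have hζr : IsPrimitiveRoot (ζ ^ nb) r := hζ.pow (Nat.pos_of_ne_zero hN) rfl
  have hmaps : Set.MapsTo (fun x : K => x ^ nb) (primitiveRoots j K) (primitiveRoots r K) := by
    intro x hx
    rw [Finset.mem_coe, mem_primitiveRoots (Nat.pos_of_ne_zero hj0)] at hx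
    rw [Finset.mem_coe, mem_primitiveRoots (Nat.pos_of_ne_zero hr),
      ← (orderOf_mem_chi_iff hnb hr (x := x) (by rwa [← hx.eq_orderOf])).1 (hx.eq_orderOf ▸ hj)]
    exact IsPrimitiveRoot.orderOf _
  have hsum := Finset.card_eq_sum_card_fiberwise hmaps
  rw [hζj.card_primitiveRoots] at hsum
  rw [hsum, Finset.sum_congr rfl (g := fun _ => ((primitiveRoots j K).filter (· ^ nb = a)).card),
    Finset.sum_const, hζr.card_primitiveRoots, smul_eq_mul, mul_comm]
  intro b hb
  have hb' := (mem_primitiveRoots (Nat.pos_of_ne_zero hr)).1 hb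
  exact le_antisymm (card_pow_fiber_le hj0 hrj hb'.eq_orderOf.symm ha)
    (card_pow_fiber_le hj0 hrj ha hb'.eq_orderOf.symm)

end Counting

/-! ### Self-conjugacy read off from orders of roots -/

section Roots

variable {F : Type*} [Field F] {q : ℕ} {φ : F →+* F} {K : Type*} [Field K] [Algebra F K]

/-- Reversal inverts roots, and the twisted polynomial takes the value `f(x)^q` at `x^q`. -/
theorem aeval_dagger_eq_zero_iff (hφ : ∀ x, φ x = x ^ q) {ψ : K →+* K} (hψ : ∀ x, ψ x = x ^ q)
    {f : F[X]} (h0 : f.coeff 0 ≠ 0) {x : K} (hx : x ≠ 0) :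
    aeval (x ^ q)⁻¹ (dagger q f) = 0 ↔ aeval x f = 0 := by
  have hxq : x ^ q ≠ 0 := pow_ne_zero q hx
  let := invertibleOfNonzero hxq
  have hcomp : (algebraMap F K).comp φ = ψ.comp (algebraMap F K) := by
    ext a
    simp [hφ, hψ]
  have hc : algebraMap F K (φ (f.coeff 0))⁻¹ ≠ 0 := by simpa using h0
  have h2 : eval₂ (algebraMap F K) (x ^ q) (f.map φ) = ψ (aeval x f) := by
    rw [eval₂_map, hcomp, ← hψ, ← hom_eval₂, aeval_def]
  rw [dagger_eq hφ, map_mul, aeval_C, mul_eq_zero, or_iff_right hc, aeval_def, ← invOf_eq_inv,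
    eval₂_reverse_eq_zero_iff, h2, map_eq_zero]

theorem frobenius_pow_apply [Fintype F] [Finite K] (k : ℕ) (x : K) :
    (FiniteField.frobeniusAlgEquivOfAlgebraic F K ^ k) x = x ^ Fintype.card F ^ k := by
  induction k with
  | zero => simp
  | succ k ih =>
    rw [pow_succ', AlgEquiv.mul_apply, ih, FiniteField.coe_frobeniusAlgEquivOfAlgebraic, pow_succ,
      pow_mul]

theorem ne_zero_of_aeval_eq_zero {f : F[X]} (h0 : f.coeff 0 ≠ 0) {x : K} (hx : aeval x f = 0) :
    x ≠ 0 := by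
  rintro rfl
  rw [← coeff_zero_eq_aeval_zero', map_eq_zero] at hx
  exact h0 hx

/-- A monic irreducible polynomial over `𝔽_{q²}` is self-conjugate-reciprocal iff its roots have
order in `M_q`. -/
theorem eq_dagger_iff_orderOf_mem [Fintype F] [Finite K] (hF : Fintype.card F = q ^ 2)
    (hφ : ∀ x, φ x = x ^ q) {ψ : K →+* K} (hψ : ∀ x, ψ x = x ^ q) {g : F[X]} (hg : g.Monic)
    (hi : Irreducible g) (h0 : g.coeff 0 ≠ 0) {x : K} (hx : aeval x g = 0) :
    g = dagger q g ↔ orderOf x ∈ M q := by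
  have hx0 : x ≠ 0 := ne_zero_of_aeval_eq_zero h0 hx
  have hd : aeval (x ^ q)⁻¹ (dagger q g) = 0 := (aeval_dagger_eq_zero_iff hφ hψ h0 hx0).2 hx
  constructor
  · intro h
    rw [← h] at hd
    have hc : IsConjRoot F (x ^ q)⁻¹ x := by
      rw [IsConjRoot, ← minpoly.eq_of_irreducible_of_monic hi hx hg,
        ← minpoly.eq_of_irreducible_of_monic hi hd hg]
    obtain ⟨σ, hσ⟩ := isConjRoot_iff_exists_algEquiv.1 hc
    obtain ⟨k, rfl⟩ := (FiniteField.bijective_frobeniusAlgEquivOfAlgebraic_pow F K).2 σ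
    simp only [frobenius_pow_apply, hF] at hσ
    have hone : x ^ (q ^ 2) ^ (k : ℕ) * x ^ q = 1 := by
      rw [hσ, inv_mul_cancel₀ (pow_ne_zero q hx0)]
    suffices h : ∃ i : ℕ, 0 < i ∧ Odd i ∧ x ^ (q ^ i + 1) = 1 by
      obtain ⟨i, hi0, hio, hix⟩ := h
      have hdvd := orderOf_dvd_of_pow_eq_one hix
      exact ⟨Nat.pos_of_dvd_of_pos hdvd (Nat.succ_pos _), i, hi0, hio, hdvd⟩
    -- For `k = l + 1`, `hone` is the `q`-th power of the wanted identity with `i = 2l + 1`, so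
    -- injectivity of `ψ` is needed; `k = 0` gives `i = 1` directly.
    rcases hk : (k : ℕ) with _ | l
    · refine ⟨1, one_pos, odd_one, ?_⟩
      rw [hk, pow_zero, pow_one, ← pow_succ'] at hone
      rwa [pow_one]
    · refine ⟨2 * l + 1, by omega, ⟨l, rfl⟩, ψ.injective ?_⟩
      rw [hψ, map_one, ← pow_mul, ← hone, hk, ← pow_add]
      congr 1
      ring
  · rintro ⟨-, i, -, ⟨k, rfl⟩, hdvd⟩
    have hone : x ^ (q ^ (2 * k + 1) + 1) = 1 := orderOf_dvd_iff_pow_eq_one.1 hdvd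
    have hy : (x ^ q)⁻¹ = (FiniteField.frobeniusAlgEquivOfAlgebraic F K ^ (k + 1)) x := by
      rw [frobenius_pow_apply, hF]
      refine inv_eq_of_mul_eq_one_right ?_
      have : x ^ q * x ^ (q ^ 2) ^ (k + 1) = (x ^ (q ^ (2 * k + 1) + 1)) ^ q := by
        rw [← pow_mul, ← pow_mul, ← pow_add]
        congr 1
        ring
      rw [this, hone, one_pow]
    have hgy : aeval (x ^ q)⁻¹ g = 0 := by
      rw [hy]
      have := aeval_algHom_apply
        ((FiniteField.frobeniusAlgEquivOfAlgebraic F K ^ (k + 1) : K ≃ₐ[F] K) : K →ₐ[F] K) x g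
      rw [hx, map_zero] at this
      exact this
    have hdvd : g ∣ dagger q g := by
      have h := minpoly.eq_of_irreducible_of_monic hi hgy hg
      conv_lhs => rw [h]
      exact minpoly.dvd F _ hd
    exact eq_of_dvd_of_natDegree_le_of_leadingCoeff hdvd (natDegree_dagger hφ h0).le
      (hg.leadingCoeff.trans (dagger_monic hφ h0).leadingCoeff.symm)

open Classical in
/-- The self-conjugate-reciprocal part of a factorization collects the roots whose order is
in `M_q`. -/
theorem Factorization.B_eq_card [Fintype F] [Finite K] (hF : Fintype.card F = q ^ 2)
    (hφ : ∀ x, φ x = x ^ q) {ψ : K →+* K} (hψ : ∀ x, ψ x = x ^ q) {P : F[X]} (hP : P ≠ 0)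
    (hs : (P.map (algebraMap F K)).Splits) (fac : Factorization q P) :
    fac.B = ((P.aroots K).filter (fun x => orderOf x ∈ M q)).card := by
  have hP' := hP
  rw [fac.eq_prod] at hP'
  set G := ∏ i, fac.g i with hG
  have hGs : (G.map (algebraMap F K)).Splits := by
    refine hs.of_dvd ((Polynomial.map_ne_zero_iff (algebraMap F K).injective).2 hP) ?_
    exact Polynomial.map_dvd _ ⟨_, fac.eq_prod⟩
  have hB : fac.B = (G.aroots K).card := by
    rw [Factorization.B, aroots, ← hGs.natDegree_eq_card_roots, natDegree_map, hG,
      natDegree_prod_of_monic _ _ fun i _ => fac.g_monic i]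
  have h1 : (G.aroots K).filter (fun x => orderOf x ∈ M q) = G.aroots K := by
    refine Multiset.filter_eq_self.2 fun x hx => ?_
    have hx := (mem_aroots.1 hx).2
    rw [hG, map_prod, Finset.prod_eq_zero_iff] at hx
    obtain ⟨i, -, hx⟩ := hx
    exact (eq_dagger_iff_orderOf_mem hF hφ hψ (fac.g_monic i) (fac.g_irreducible i)
      (fac.g_self i).1 hx).1 (fac.g_self i).2
  have h2 : ((∏ j, (fac.f j * dagger q (fac.f j))).aroots K).filter
      (fun x => orderOf x ∈ M q) = 0 := by
    refine Multiset.filter_eq_nil.2 fun x hx hM => ?_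
    have hx := (mem_aroots.1 hx).2
    rw [map_prod, Finset.prod_eq_zero_iff] at hx
    obtain ⟨j, -, hx⟩ := hx
    have h0 := (fac.f_pair j).1
    have key : ∀ y : K, aeval y (fac.f j) = 0 → orderOf y ∉ M q := fun y hy hM =>
      (fac.f_pair j).2 ((eq_dagger_iff_orderOf_mem hF hφ hψ (fac.f_monic j) (fac.f_irreducible j)
        h0 hy).2 hM)
    rw [map_mul, mul_eq_zero] at hx
    rcases hx with hx | hx
    · exact key x hx hM
    · have hx0 : x ≠ 0 := by
        refine ne_zero_of_aeval_eq_zero ?_ hx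
        rw [coeff_zero_dagger hφ (fac.f_monic j)]
        exact inv_ne_zero ((map_ne_zero φ).2 h0)
      -- Writes the root of `f†` as `z^(-q)`, with `z` a root of `f` of the same order.
      obtain ⟨z, hz⟩ := (Finite.injective_iff_surjective.1 ψ.injective) x⁻¹
      have hz0 : z ≠ 0 := by
        rintro rfl
        rw [map_zero] at hz
        exact inv_ne_zero hx0 hz.symm
      have hxz : x = (z ^ q)⁻¹ := by rw [← hψ, hz, inv_inv]
      rw [hxz, aeval_dagger_eq_zero_iff hφ hψ h0 hz0] at hx
      refine key z hx ?_
      have ho : orderOf z = orderOf x := by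
        rw [← orderOf_injective (ψ : K →* K) ψ.injective z]
        show orderOf (ψ z) = _
        rw [hz]
        exact orderOf_eq_orderOf_iff.2 fun k => by rw [inv_pow, inv_eq_one]
      rwa [ho]
  rw [hB, ← h1]
  conv_rhs => rw [fac.eq_prod, aroots_mul hP', Multiset.filter_add, h2, add_zero]

end Roots

end HermitianHull

/-! ### The main theorem -/

open Classical in
theorem lemma2 {F : Type*} [Field F] [Fintype F] (p m q : ℕ) (hp : p.Prime) (hm : 0 < m)
    (hq : q = p ^ m) (hF : Fintype.card F = q ^ 2)
    (n nb ν : ℕ) (hn : n = nb * p ^ ν) (hnb : ¬ p ∣ nb)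
    (lam Lam : F) (hlam : lam ≠ 0) (r : ℕ) (hr : orderOf lam = r) (hrq : r ∣ q + 1)
    (hLam : Lam ^ p ^ ν = lam) :
    Nonempty (HermitianHull.Factorization q (X ^ nb - C Lam : F[X])) ∧
    ∀ fac : HermitianHull.Factorization q (X ^ nb - C Lam : F[X]),
      (fac.B : ℚ) =
        ∑ j ∈ (HermitianHull.chi nb r).filter (fun j => j ∈ HermitianHull.M q),
          (Nat.totient j : ℚ) / (Nat.totient r : ℚ) := by
  have : Fact p.Prime := ⟨hp⟩
  have hcharF : CharP F p := by
    obtain ⟨p', hp'⟩ := CharP.exists F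
    obtain ⟨k, hp'p, hk⟩ := FiniteField.card F p'
    have hdvd : p' ∣ (p ^ m) ^ 2 := by
      rw [← hq, ← hF, hk]
      exact dvd_pow_self p' k.ne_zero
    rwa [(Nat.prime_dvd_prime_iff_eq hp'p hp).1
      (hp'p.dvd_of_dvd_pow (hp'p.dvd_of_dvd_pow hdvd))] at hp'
  have hnb0 : nb ≠ 0 := fun h => hnb (h ▸ dvd_zero p)
  have hr0 : r ≠ 0 := fun h => by simp [h] at hrq
  have hφ : ∀ x, iterateFrobenius F p m x = x ^ q := fun x => by
    rw [iterateFrobenius_def, hq]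
  have hLr : orderOf Lam = r := by
    rw [← hr, ← hLam]
    exact (orderOf_injective (iterateFrobenius F p ν : F →* F)
      (iterateFrobenius F p ν).injective Lam).symm
  have hL0 : Lam ≠ 0 := by
    rintro rfl
    rw [zero_pow (pow_ne_zero _ hp.ne_zero)] at hLam
    exact hlam hLam.symm
  have hLq : Lam ^ (q + 1) = 1 := orderOf_dvd_iff_pow_eq_one.1 (hLr ▸ hrq)
  refine ⟨?_, fun fac => ?_⟩
  · refine HermitianHull.Factorization.nonempty_of_dagger_eq hφ (fun x => ?_) _
      (monic_X_pow_sub_C Lam hnb0) ?_ (HermitianHull.dagger_X_pow_sub_C hφ hnb0 hLq)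
    · rw [hφ, hφ, ← pow_mul, ← sq, ← hF, FiniteField.pow_card]
    · simpa [hnb0.symm] using hL0
  -- Ensures that a primitive `nb * r`-th root of unity exists in an extension.
  have hpN : ¬ p ∣ nb * r := by
    rw [hp.dvd_mul, not_or]
    refine ⟨hnb, fun h => hp.one_lt.ne' ?_⟩
    have hpq : p ∣ q := hq ▸ dvd_pow_self p hm.ne'
    exact Nat.dvd_one.1 ((Nat.dvd_add_right hpq).1 (h.trans hrq))
  have hNF : NeZero ((nb * r : ℕ) : F) := ⟨fun h => hpN ((CharP.cast_eq_zero_iff F p _).1 h)⟩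
  have hN : NeZero (nb * r) := ⟨mul_ne_zero hnb0 hr0⟩
  obtain ⟨K, _, _, _, ζ, hζ⟩ : ∃ (K : Type _) (_ : Field K) (_ : Algebra F K)
      (_ : FiniteDimensional F K) (ζ : K), IsPrimitiveRoot ζ (nb * r) :=
    ⟨CyclotomicField (nb * r) F, inferInstance, inferInstance,
      IsCyclotomicExtension.finiteDimensional {nb * r} F _, _,
      IsCyclotomicExtension.zeta_spec (nb * r) F _⟩
  have : Finite K := Module.finite_of_finite F
  have hcharK : CharP K p := charP_of_injective_algebraMap (algebraMap F K).injective p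
  have hψ : ∀ x : K, iterateFrobenius K p m x = x ^ q := fun x => by
    rw [iterateFrobenius_def, hq]
  set a : K := algebraMap F K Lam with ha
  have har : orderOf a = r := by
    rw [← hLr]
    exact orderOf_injective (algebraMap F K : F →* K) (algebraMap F K).injective Lam
  have ha0 : a ≠ 0 := (_root_.map_ne_zero _).2 hL0
  have hmap : (X ^ nb - C Lam : F[X]).map (algebraMap F K) = X ^ nb - C a := by
    rw [Polynomial.map_sub, Polynomial.map_pow, map_X, map_C]
  -- It divides `x^(nb r) - a^r = x^(nb r) - 1`.
  have hsplit : (X ^ nb - C a : K[X]).Splits := by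
    refine (X_pow_sub_one_splits hζ).of_dvd (X_pow_sub_C_ne_zero (NeZero.pos _) 1) ?_
    have hone : a ^ r = 1 := har ▸ pow_orderOf_eq_one a
    rw [pow_mul, ← hone, C_pow]
    exact sub_dvd_pow_sub_pow _ _ r
  have hsep : (X ^ nb - C a : K[X]).Separable :=
    separable_X_pow_sub_C a (fun h => hnb ((CharP.cast_eq_zero_iff K p _).1 h)) ha0
  have hP0 : (X ^ nb - C Lam : F[X]) ≠ 0 := X_pow_sub_C_ne_zero (Nat.pos_of_ne_zero hnb0) Lam
  have hB := fac.B_eq_card hF hφ hψ hP0 (hmap ▸ hsplit)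
  rw [aroots, hmap] at hB
  have hroot : ∀ x : K, x ∈ (X ^ nb - C a : K[X]).roots ↔ x ^ nb = a := fun x => by
    rw [mem_roots (X_pow_sub_C_ne_zero (Nat.pos_of_ne_zero hnb0) a), IsRoot.def, eval_sub,
      eval_pow, eval_X, eval_C, sub_eq_zero]
  have hfin : ∀ x : K, x ^ nb = a → orderOf x ≠ 0 := fun x hx h => by
    have h1 : x ^ (nb * r) = 1 := by rw [pow_mul, hx, ← har, pow_orderOf_eq_one]
    exact hN.out (Nat.eq_zero_of_zero_dvd (h ▸ orderOf_dvd_of_pow_eq_one h1))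
  have hnodup := (nodup_roots hsep).filter (fun x => orderOf x ∈ HermitianHull.M q)
  rw [← Multiset.toFinset_card_of_nodup hnodup, Finset.card_eq_sum_card_fiberwise
    (f := orderOf) (t := (HermitianHull.chi nb r).filter (fun j => j ∈ HermitianHull.M q))] at hB
  · rw [hB, Nat.cast_sum]
    refine Finset.sum_congr rfl fun j hj => ?_
    obtain ⟨hj, hjM⟩ := Finset.mem_filter.1 hj
    have hφr : (r.totient : ℚ) ≠ 0 :=
      Nat.cast_ne_zero.2 (Nat.totient_pos.2 (Nat.pos_of_ne_zero hr0)).ne'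
    have hj0 : j ≠ 0 := ((HermitianHull.mem_chi_iff hnb0 hr0).1 hj).1
    rw [eq_div_iff hφr, ← HermitianHull.card_pow_fiber_mul_totient hnb0 hr0 hζ hj har,
      Nat.cast_mul]
    congr 3
    ext x
    rw [Finset.mem_filter, Finset.mem_filter, Multiset.mem_toFinset, Multiset.mem_filter, hroot,
      mem_primitiveRoots (Nat.pos_of_ne_zero hj0), IsPrimitiveRoot.iff_orderOf]
    constructor
    · rintro ⟨⟨hx, -⟩, ho⟩
      exact ⟨ho, hx⟩
    · rintro ⟨ho, hx⟩
      exact ⟨⟨hx, ho ▸ hjM⟩, ho⟩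
  · intro x hx
    rw [Finset.mem_coe, Multiset.mem_toFinset, Multiset.mem_filter, hroot] at hx
    rw [Finset.mem_coe, Finset.mem_filter,
      HermitianHull.orderOf_mem_chi_iff hnb0 hr0 (hfin x hx.1), hx.1]
    exact ⟨har, hx.2⟩
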